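/- Let $L^*$ denote the typical countable lattice, i.e. the Fraïssé limit of the class of all finite lattices (the empty lattice being allowed). Explicitly, $L^*$ is a countable lattice such that: (i) $L^*$ is locally finite, i.e. every finite subset of $L^*$ is contained in a finite sublattice; (ii) whenever $A$ is a finite sublattice of $L^*$ and $B$ is a finite lattice containing $A$ as a sublattice, there is a sublattice $B'$ of $L^*$ with $A\le B'$ and an isomorphism $B\to B'$ that is the identity on $A$; (iii) every finite lattice embeds into $L^*$. Such a lattice exists, and every such lattice $L^*$ has the following two properties. (1) (Monotone interpolation property.) For every $n$, every monotone function $f:(L^*)^n\to L^*$ (with respect to the componentwise order), and every finite sublattice $A\le L^*$, there is a lattice polynomial $p(x_1,\dots,x_n)$, i.e. a term built from the variables $x_1,\dots,x_n$ and constants from $L^*$ by means of $\vee$ and $\wedge$, such that $p(\vec a)=f(\vec a)$ for all $\vec a\in A^n$. (2) $L^*$ is simple, i.e. its only congruence relations are equality and the total relation. -/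

import Mathlib

universe u

/-- Lattice polynomials in the variables `x₀, …, xₙ₋₁` with coefficients in `L`. -/
inductive LatticePolynomial (L : Type*) (n : ℕ) where
  | var (i : Fin n) : LatticePolynomial L n
  | coeff (c : L) : LatticePolynomial L n
  | join (p q : LatticePolynomial L n) : LatticePolynomial L n
  | meet (p q : LatticePolynomial L n) : LatticePolynomial L n

/-- The function `Lⁿ → L` induced by a lattice polynomial. -/
def LatticePolynomial.eval {L : Type*} [Lattice L] {n : ℕ} (x : Fin n → L) :
    LatticePolynomial L n → L
  | .var i => x i
  | .coeff c => c
  | .join p q => p.eval x ⊔ q.eval x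
  | .meet p q => p.eval x ⊓ q.eval x

/-- Every monotone function is induced, on any given finite sublattice, by a lattice polynomial
with coefficients in `L`. -/
def MonotoneInterpolationProperty (L : Type*) [Lattice L] : Prop :=
  ∀ (n : ℕ) (f : (Fin n → L) → L), Monotone f →
    ∀ A : Sublattice L, (A : Set L).Finite →
      ∃ p : LatticePolynomial L n, ∀ x : Fin n → L, (∀ i, x i ∈ A) → p.eval x = f x

/-- `L` has no congruence relations other than equality and the total relation. -/
def IsSimpleLattice (L : Type*) [Lattice L] : Prop :=
  ∀ c : LatticeCon L, (∀ x y : L, c.r x y → x = y) ∨ (∀ x y : L, c.r x y)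

/-- `L` is a locally finite countable Fraïssé structure (Fraïssé limit) for the class of all
finite lattices. The empty lattice is allowed as a finite lattice and as a sublattice. The
requirement that all finite substructures of `L` belong to the class holds automatically, since
a finite sublattice is a finite lattice. -/
structure IsTypicalCountableLattice (L : Type u) [Lattice L] : Prop where
  countable : Countable L
  /-- Every finite subset lies in a finite sublattice. -/
  locally_finite : ∀ s : Set L, s.Finite → ∃ A : Sublattice L, s ⊆ A ∧ (A : Set L).Finite
  /-- Ultrahomogeneity: a finite extension `B` of a finite sublattice `A` of `L` is realized
  inside `L` over `A`. -/
  ultrahomogeneous : ∀ A : Sublattice L, (A : Set L).Finite →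
    ∀ (B : Type u) [Lattice B] [Finite B] (i : LatticeHom A B), Function.Injective i →
      ∃ j : LatticeHom B L, Function.Injective j ∧ ∀ a : A, j (i a) = (a : L)
  /-- Universality: every finite lattice embeds into `L`. -/
  universal : ∀ (B : Type u) [Lattice B] [Finite B],
    ∃ j : LatticeHom B L, Function.Injective j

/-! Interpolation: it suffices to find, for any two points `b` and `x`, a polynomial that is at
least `f b` at `b` and at most `f x` at `x`. Meets over `x` and then joins over `b` give equality on
a finite set. If `b ≤ x`, the constant `f b` works by monotonicity. Otherwise some coordinate has `b
i ≰ x i`, and a unary polynomial in that coordinate separates the two values. Its coefficients come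
from `DiamondExt`, a finite extension that ultrahomogeneity realizes inside `L`.

Simplicity: polynomials preserve congruences. If two distinct elements are congruent, so are their
meet and join, and a polynomial interpolating a two-valued step function carries that pair to `u ⊓
v` and `u ⊔ v` for arbitrary `u`, `v`.

Existence: finite lattices amalgamate, inside the finite lattice of pairs of ideals with a common
trace. Hence all extension problems of a finite lattice `M` into a given `B` are solved in one
finite extension of `M`. A chain in which every isomorphism type is treated infinitely often has a
typical direct limit. -/

/-! ### A finite extension that separates two points -/

/-- The extension of a lattice `A` by a new bottom, a new top and two elements `d`, `e` incomparable
to everything in between, together with an element `c` below exactly the elements above `y`. -/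
inductive DiamondExt (A : Type u) (y : A) : Type u
  | of (z : A) | bot | top | c | d | e

namespace DiamondExt

variable {A : Type u} {y : A}

instance [Finite A] : Finite (DiamondExt A y) := by
  let g : A ⊕ Fin 5 → DiamondExt A y :=
    Sum.elim of ![bot, top, c, d, e]
  refine Finite.of_surjective g ?_
  rintro (z | _ | _ | _ | _ | _)
  exacts [⟨.inl z, rfl⟩, ⟨.inr 0, rfl⟩, ⟨.inr 1, rfl⟩, ⟨.inr 2, rfl⟩, ⟨.inr 3, rfl⟩, ⟨.inr 4, rfl⟩]

variable [Lattice A]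

/-- The order of `DiamondExt A y`. -/
def Le : DiamondExt A y → DiamondExt A y → Prop
  | bot, _ => True
  | _, top => True
  | of z, of w => z ≤ w
  | c, of w => y ≤ w
  | c, c => True
  | d, d => True
  | e, e => True
  | _, _ => False

/-- The join of `DiamondExt A y`. -/
def join : DiamondExt A y → DiamondExt A y → DiamondExt A y
  | bot, x => x
  | x, bot => x
  | of z, of w => of (z ⊔ w)
  | of z, c => of (z ⊔ y)
  | c, of w => of (y ⊔ w)
  | c, c => c
  | d, d => d
  | e, e => e
  | _, _ => top

open Classical in
/-- The meet of `DiamondExt A y`. -/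
noncomputable def meet : DiamondExt A y → DiamondExt A y → DiamondExt A y
  | top, x => x
  | x, top => x
  | of z, of w => of (z ⊓ w)
  | of z, c => if y ≤ z then c else bot
  | c, of w => if y ≤ w then c else bot
  | c, c => c
  | d, d => d
  | e, e => e
  | _, _ => bot

noncomputable instance : Lattice (DiamondExt A y) where
  le := Le
  sup := join
  inf := meet
  le_refl := by rintro (_ | _) <;> simp [Le]
  le_trans := by
    rintro (_ | _) (_ | _) (_ | _) <;> simp only [Le] <;> grind
  le_antisymm := by
    rintro (_ | _) (_ | _) <;> simp only [Le] <;> grind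
  le_sup_left := by rintro (_ | _) (_ | _) <;> simp [Le, join]
  le_sup_right := by rintro (_ | _) (_ | _) <;> simp [Le, join]
  sup_le := by rintro (_ | _) (_ | _) (_ | _) <;> simp +contextual [Le, join]
  inf_le_left := by rintro (_ | _) (_ | _) <;> simp only [meet] <;> (try split_ifs) <;> simp [Le, *]
  inf_le_right := by rintro (_ | _) (_ | _) <;> simp only [meet] <;> (try split_ifs) <;> simp [Le, *]
  le_inf := by
    rintro (_ | _) (_ | _) (_ | _) <;> simp only [meet] <;> (try split_ifs) <;> simp only [Le] <;>
      grind [le_inf]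

/-- The inclusion of `A` into `DiamondExt A y`. -/
def ofHom (y : A) : LatticeHom A (DiamondExt A y) where
  toFun := of
  map_sup' _ _ := rfl
  map_inf' _ _ := rfl

theorem ofHom_injective (y : A) : Function.Injective (ofHom y) := fun _ _ h => of.inj h

end DiamondExt

/-! ### Monotone interpolation -/

namespace IsTypicalCountableLattice

variable {L : Type u} [Lattice L]

/-- Points that are not in order reverse are separated by a unary polynomial, with the values
arbitrarily far apart. -/
theorem exists_separating_coeff (hL : IsTypicalCountableLattice L) {a b : L} (hab : ¬ b ≤ a)
    (u v : L) : ∃ c d e : L, (a ⊓ c) ⊔ (((a ⊓ c) ⊔ d) ⊓ e) ≤ u ∧ v ≤ (b ⊓ c) ⊔ (((b ⊓ c) ⊔ d) ⊓ e) := by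
  obtain ⟨A, hA, hfin⟩ := hL.locally_finite {a, b, u, v} (by simp)
  have ha : a ∈ A := hA (by simp)
  have hb : b ∈ A := hA (by simp)
  have hu : u ∈ A := hA (by simp)
  have hv : v ∈ A := hA (by simp)
  have : Finite A := hfin
  obtain ⟨j, -, hj⟩ := hL.ultrahomogeneous A hfin _ (DiamondExt.ofHom (⟨b, hb⟩ : A))
    (DiamondExt.ofHom_injective _)
  refine ⟨j .c, j .d, j .e, ?_, ?_⟩
  -- As `b ≰ a`, the meet of `a` and `c` is the new bottom, and the rest collapses because `d ⊓ e =
  -- bot`. The new bottom lies below `u`.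
  · have key : ((DiamondExt.of ⟨a, ha⟩ ⊓ .c) ⊔ (((.of ⟨a, ha⟩ ⊓ .c) ⊔ .d) ⊓ .e) :
        DiamondExt A ⟨b, hb⟩) = .bot := by
      have h1 : (DiamondExt.of ⟨a, ha⟩ ⊓ .c : DiamondExt A ⟨b, hb⟩) = .bot := if_neg hab
      rw [h1]; rfl
    have h2 : j .bot ≤ j (DiamondExt.ofHom (⟨b, hb⟩ : A) ⟨u, hu⟩) := OrderHomClass.mono j trivial
    rw [hj, ← key] at h2
    have h3 : j (.of ⟨a, ha⟩) = a := hj ⟨a, ha⟩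
    simpa only [map_sup, map_inf, h3] using h2
  -- Here `b ⊓ c = c`. Then `c ⊔ d = top` lets `e` through, and `c ⊔ e = top`, which lies above `v`.
  · have key : ((DiamondExt.of ⟨b, hb⟩ ⊓ .c) ⊔ (((.of ⟨b, hb⟩ ⊓ .c) ⊔ .d) ⊓ .e) :
        DiamondExt A ⟨b, hb⟩) = .top := by
      have h1 : (DiamondExt.of ⟨b, hb⟩ ⊓ .c : DiamondExt A ⟨b, hb⟩) = .c := if_pos le_rfl
      rw [h1]; rfl
    have h2 : j (DiamondExt.ofHom (⟨b, hb⟩ : A) ⟨v, hv⟩) ≤ j .top := OrderHomClass.mono j trivial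
    rw [hj, ← key] at h2
    have h3 : j (.of ⟨b, hb⟩) = b := hj ⟨b, hb⟩
    simpa only [map_sup, map_inf, h3] using h2

theorem exists_polynomial_of_pair (hL : IsTypicalCountableLattice L) {n : ℕ}
    {f : (Fin n → L) → L} (hf : Monotone f) (b x : Fin n → L) :
    ∃ p : LatticePolynomial L n, f b ≤ p.eval b ∧ p.eval x ≤ f x := by
  by_cases h : b ≤ x
  · exact ⟨.coeff (f b), le_rfl, hf h⟩
  · obtain ⟨i, hi⟩ := not_forall.1 h
    obtain ⟨c, d, e, h0, h1⟩ := hL.exists_separating_coeff hi (f x) (f b)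
    let q : LatticePolynomial L n := .meet (.var i) (.coeff c)
    exact ⟨.join q (.meet (.join q (.coeff d)) (.coeff e)), h1, h0⟩

/-- Take the meet over `S` of the polynomials for the pairs `(b, x)`: every factor is at least `f b`
at `b`, and each `x ∈ S` is bounded by its own factor. -/
theorem exists_polynomial_le_of_finite (hL : IsTypicalCountableLattice L) {n : ℕ}
    {f : (Fin n → L) → L} (hf : Monotone f) (b : Fin n → L) {S : Set (Fin n → L)} (hS : S.Finite) :
    ∃ p : LatticePolynomial L n, f b ≤ p.eval b ∧ ∀ x ∈ S, p.eval x ≤ f x := by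
  induction S, hS using Set.Finite.induction_on with
  | empty => exact ⟨.coeff (f b), le_rfl, by simp⟩
  | @insert y S _ _ ih =>
    obtain ⟨p, hp, hpS⟩ := ih
    obtain ⟨q, hq, hqy⟩ := hL.exists_polynomial_of_pair hf b y
    refine ⟨.meet p q, le_inf hp hq, ?_⟩
    rintro x (rfl | hx)
    exacts [inf_le_right.trans hqy, inf_le_left.trans (hpS x hx)]

/-- Take the join over `b ∈ S` of polynomials that lie below `f` on `S` and reach `f b` at `b`. -/
theorem exists_polynomial_eq_of_finite (hL : IsTypicalCountableLattice L) {n : ℕ}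
    {f : (Fin n → L) → L} (hf : Monotone f) {S : Set (Fin n → L)} (hS : S.Finite)
    (hne : S.Nonempty) : ∃ p : LatticePolynomial L n, ∀ x ∈ S, p.eval x = f x := by
  suffices h : ∀ T : Set (Fin n → L), T.Finite → ∃ p : LatticePolynomial L n,
      (∀ x ∈ T, f x ≤ p.eval x) ∧ ∀ x ∈ S, p.eval x ≤ f x by
    obtain ⟨p, h1, h2⟩ := h S hS
    exact ⟨p, fun x hx => (h2 x hx).antisymm (h1 x hx)⟩
  intro T hT
  induction T, hT using Set.Finite.induction_on with
  | empty =>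
    -- There is no empty join to start from, so any polynomial below `f` on `S` serves; a point of
    -- `S` supplies one.
    obtain ⟨p, -, hp⟩ := hL.exists_polynomial_le_of_finite hf hne.some hS
    exact ⟨p, by simp, hp⟩
  | @insert y T _ _ ih =>
    obtain ⟨p, hp, hpS⟩ := ih
    obtain ⟨q, hq, hqS⟩ := hL.exists_polynomial_le_of_finite hf y hS
    refine ⟨.join p q, ?_, fun x hx => sup_le (hpS x hx) (hqS x hx)⟩
    rintro x (rfl | hx)
    exacts [hq.trans le_sup_right, (hp x hx).trans le_sup_left]

theorem monotoneInterpolationProperty (hL : IsTypicalCountableLattice L) :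
    MonotoneInterpolationProperty L := by
  intro n f hf A hA
  rcases Set.eq_empty_or_nonempty {x : Fin n → L | ∀ i, x i ∈ A} with h | h
  -- Nothing is to be interpolated, but some polynomial must exist; universality yields an element
  -- of `L` to serve as a constant.
  · obtain ⟨j, -⟩ := hL.universal PUnit
    exact ⟨.coeff (j ⟨⟩), fun x hx => (Set.eq_empty_iff_forall_notMem.1 h x hx).elim⟩
  · exact hL.exists_polynomial_eq_of_finite hf (Set.Finite.pi' fun _ => hA) h

end IsTypicalCountableLattice

/-! ### Simplicity -/

theorem LatticeCon.r_eval {L : Type*} [Lattice L] (c : LatticeCon L) {n : ℕ} {x y : Fin n → L}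
    (h : ∀ i, c.r (x i) (y i)) (p : LatticePolynomial L n) : c.r (p.eval x) (p.eval y) := by
  induction p with
  | var i => exact h i
  | coeff a => exact c.refl a
  | join p q hp hq => exact c.sup hp hq
  | meet p q hp hq => exact c.inf hp hq

theorem MonotoneInterpolationProperty.isSimpleLattice {L : Type*} [Lattice L]
    (hL : MonotoneInterpolationProperty L)
    (hfin : ∀ s : Set L, s.Finite → ∃ A : Sublattice L, s ⊆ A ∧ (A : Set L).Finite) :
    IsSimpleLattice L := by
  classical
  intro c
  refine or_iff_not_imp_left.2 fun hne u v => ?_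
  push Not at hne
  obtain ⟨x, y, hxy, hne⟩ := hne
  have hlt : x ⊓ y < x ⊔ y := inf_lt_sup.2 hne
  have hr : c.r (x ⊓ y) (x ⊔ y) := c.r_inf_sup_iff.2 hxy
  -- This step function jumps between `x ⊓ y` and `x ⊔ y`, so its interpolant makes `u ⊓ v` and `u ⊔
  -- v` congruent.
  let f : (Fin 1 → L) → L := fun t => if t 0 ≤ x ⊓ y then u ⊓ v else u ⊔ v
  have hf : Monotone f := by
    intro s t hst
    have h0 : s 0 ≤ t 0 := hst 0
    by_cases ht : t 0 ≤ x ⊓ y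
    · simp only [f, ht, h0.trans ht, if_true, le_rfl]
    · simp only [f, ht, if_false]
      split_ifs
      exacts [inf_le_sup, le_rfl]
  obtain ⟨A, hA, hAfin⟩ := hfin {x ⊓ y, x ⊔ y} (by simp)
  obtain ⟨p, hp⟩ := hL 1 f hf A hAfin
  have key := c.r_eval (x := fun _ : Fin 1 => x ⊓ y) (y := fun _ => x ⊔ y) (fun _ => hr) p
  rw [hp _ fun _ => hA (by simp), hp _ fun _ => hA (by simp)] at key
  refine c.r_inf_sup_iff.1 ?_
  simpa only [f, le_rfl, if_true, hlt.not_ge, if_false] using key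

/-! ### Amalgamation by pairs of ideals -/

namespace LatticeAmalgam

variable {A B C : Type u} [Lattice A] [Lattice B] [Lattice C]

/-- Pairs of (possibly empty) ideals of `B` and `C` with the same trace on `A`. -/
structure IdealPair (i : LatticeHom A B) (j : LatticeHom A C) : Type u where
  left : Set B
  right : Set C
  left_lower : IsLowerSet left
  right_lower : IsLowerSet right
  left_sup : SupClosed left
  right_sup : SupClosed right
  trace : ∀ a, i a ∈ left ↔ j a ∈ right

variable {i : LatticeHom A B} {j : LatticeHom A C}

theorem IdealPair.toProd_injective :
    Function.Injective fun p : IdealPair i j => (p.left, p.right) := by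
  rintro ⟨⟩ ⟨⟩ h
  simpa using h

instance [Finite B] [Finite C] : Finite (IdealPair i j) :=
  Finite.of_injective _ IdealPair.toProd_injective

instance : PartialOrder (IdealPair i j) :=
  PartialOrder.lift _ IdealPair.toProd_injective

instance : InfSet (IdealPair i j) where
  sInf S :=
    { left := {b | ∀ p ∈ S, b ∈ p.left}
      right := {c | ∀ p ∈ S, c ∈ p.right}
      left_lower := fun _ _ h hb p hp => p.left_lower h (hb p hp)
      right_lower := fun _ _ h hb p hp => p.right_lower h (hb p hp)
      left_sup := fun _ hb _ hc p hp => p.left_sup (hb p hp) (hc p hp)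
      right_sup := fun _ hb _ hc p hp => p.right_sup (hb p hp) (hc p hp)
      trace := fun a => forall₂_congr fun p _ => p.trace a }

theorem mem_left_sInf {S : Set (IdealPair i j)} {b : B} :
    b ∈ (sInf S).left ↔ ∀ p ∈ S, b ∈ p.left := Iff.rfl

theorem mem_right_sInf {S : Set (IdealPair i j)} {c : C} :
    c ∈ (sInf S).right ↔ ∀ p ∈ S, c ∈ p.right := Iff.rfl

instance : CompleteLattice (IdealPair i j) :=
  completeLatticeOfInf _ fun _ =>
    ⟨fun p hp => Prod.mk_le_mk.2
      ⟨fun _ hb => mem_left_sInf.1 hb p hp, fun _ hc => mem_right_sInf.1 hc p hp⟩,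
      fun _ hq => Prod.mk_le_mk.2
        ⟨fun _ hb => mem_left_sInf.2 fun _ hp => (hq hp).1 hb,
          fun _ hc => mem_right_sInf.2 fun _ hp => (hq hp).2 hc⟩⟩

theorem le_iff_of_injective {i : LatticeHom A B} (hi : Function.Injective i) {a b : A} :
    i a ≤ i b ↔ a ≤ b := by
  rw [← inf_eq_left, ← map_inf, hi.eq_iff, inf_eq_left]

/-- The pair of ideals generated by an element of `B`. -/
def ofLeft (i : LatticeHom A B) {j : LatticeHom A C} (hj : Function.Injective j) (b : B) :
    IdealPair i j where
  left := Set.Iic b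
  -- This is empty when no element of `A` lies below `b`, which is why empty ideals are admitted.
  right := {c | ∃ a, c ≤ j a ∧ i a ≤ b}
  left_lower := isLowerSet_Iic b
  right_lower := fun _ _ h ⟨a, h1, h2⟩ => ⟨a, h.trans h1, h2⟩
  left_sup := fun _ hx _ hy => sup_le hx hy
  right_sup := fun _ ⟨a, h1, h2⟩ _ ⟨a', h1', h2'⟩ =>
    ⟨a ⊔ a', by rw [map_sup]; exact sup_le_sup h1 h1', by rw [map_sup]; exact sup_le h2 h2'⟩
  trace := fun a => ⟨fun h => ⟨a, le_rfl, h⟩, fun ⟨_, h1, h2⟩ =>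
    (OrderHomClass.mono i ((le_iff_of_injective hj).1 h1)).trans h2⟩

/-- The pair of ideals generated by an element of `C`. -/
def ofRight {i : LatticeHom A B} (hi : Function.Injective i) (j : LatticeHom A C) (c : C) :
    IdealPair i j where
  left := {b | ∃ a, b ≤ i a ∧ j a ≤ c}
  right := Set.Iic c
  right_lower := isLowerSet_Iic c
  left_lower := fun _ _ h ⟨a, h1, h2⟩ => ⟨a, h.trans h1, h2⟩
  right_sup := fun _ hx _ hy => sup_le hx hy
  left_sup := fun _ ⟨a, h1, h2⟩ _ ⟨a', h1', h2'⟩ =>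
    ⟨a ⊔ a', by rw [map_sup]; exact sup_le_sup h1 h1', by rw [map_sup]; exact sup_le h2 h2'⟩
  trace := fun a => ⟨fun ⟨_, h1, h2⟩ =>
    (OrderHomClass.mono j ((le_iff_of_injective hi).1 h1)).trans h2, fun h => ⟨a, le_rfl, h⟩⟩

/-- The trace condition forces the right ideal of `p` to contain everything generated by the
elements of `A` below `b`. Order reflection and preservation of joins follow from this
characterization. -/
theorem ofLeft_le_iff {hj : Function.Injective j} {b : B} {p : IdealPair i j} :
    ofLeft i hj b ≤ p ↔ b ∈ p.left :=
  ⟨fun h => h.1 (le_refl b), fun h => ⟨fun _ hx => p.left_lower hx h, fun _ ⟨a, h1, h2⟩ =>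
    p.right_lower h1 ((p.trace a).1 (p.left_lower h2 h))⟩⟩

theorem ofRight_le_iff {hi : Function.Injective i} {c : C} {p : IdealPair i j} :
    ofRight hi j c ≤ p ↔ c ∈ p.right :=
  ⟨fun h => h.2 (le_refl c), fun h => ⟨fun _ ⟨a, h1, h2⟩ =>
    p.left_lower h1 ((p.trace a).2 (p.right_lower h2 h)), fun _ hx => p.right_lower hx h⟩⟩

theorem ofLeft_le_ofLeft {hj : Function.Injective j} {b b' : B} :
    ofLeft i hj b ≤ ofLeft i hj b' ↔ b ≤ b' := ofLeft_le_iff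

theorem ofRight_le_ofRight {hi : Function.Injective i} {c c' : C} :
    ofRight hi j c ≤ ofRight hi j c' ↔ c ≤ c' := ofRight_le_iff

/-- The embedding of `B` into the amalgam. -/
def leftHom (i : LatticeHom A B) {j : LatticeHom A C} (hj : Function.Injective j) :
    LatticeHom B (IdealPair i j) where
  toFun := ofLeft i hj
  map_sup' b b' := by
    refine le_antisymm (ofLeft_le_iff.2 (IdealPair.left_sup _ ?_ ?_))
      (sup_le (ofLeft_le_ofLeft.2 le_sup_left) (ofLeft_le_ofLeft.2 le_sup_right))
    exacts [ofLeft_le_iff.1 le_sup_left, ofLeft_le_iff.1 le_sup_right]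
  map_inf' b b' := by
    refine le_antisymm
      (le_inf (ofLeft_le_ofLeft.2 inf_le_left) (ofLeft_le_ofLeft.2 inf_le_right)) ⟨?_, ?_⟩
    · intro x hx
      exact le_inf ((inf_le_left : ofLeft i hj b ⊓ ofLeft i hj b' ≤ _).1 hx)
        ((inf_le_right : ofLeft i hj b ⊓ ofLeft i hj b' ≤ _).1 hx)
    -- If `a` and `a'` witness membership in the two right ideals, then `a ⊓ a'` witnesses it for `b
    -- ⊓ b'`.
    · intro x hx
      obtain ⟨a, h1, h2⟩ := (inf_le_left : ofLeft i hj b ⊓ ofLeft i hj b' ≤ _).2 hx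
      obtain ⟨a', h1', h2'⟩ := (inf_le_right : ofLeft i hj b ⊓ ofLeft i hj b' ≤ _).2 hx
      exact ⟨a ⊓ a', by rw [map_inf]; exact le_inf h1 h1',
        by rw [map_inf]; exact inf_le_inf h2 h2'⟩

/-- The embedding of `C` into the amalgam. -/
def rightHom {i : LatticeHom A B} (hi : Function.Injective i) (j : LatticeHom A C) :
    LatticeHom C (IdealPair i j) where
  toFun := ofRight hi j
  map_sup' c c' := by
    refine le_antisymm (ofRight_le_iff.2 (IdealPair.right_sup _ ?_ ?_))
      (sup_le (ofRight_le_ofRight.2 le_sup_left) (ofRight_le_ofRight.2 le_sup_right))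
    exacts [ofRight_le_iff.1 le_sup_left, ofRight_le_iff.1 le_sup_right]
  map_inf' c c' := by
    refine le_antisymm
      (le_inf (ofRight_le_ofRight.2 inf_le_left) (ofRight_le_ofRight.2 inf_le_right)) ⟨?_, ?_⟩
    · intro x hx
      obtain ⟨a, h1, h2⟩ := (inf_le_left : ofRight hi j c ⊓ ofRight hi j c' ≤ _).1 hx
      obtain ⟨a', h1', h2'⟩ := (inf_le_right : ofRight hi j c ⊓ ofRight hi j c' ≤ _).1 hx
      exact ⟨a ⊓ a', by rw [map_inf]; exact le_inf h1 h1',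
        by rw [map_inf]; exact inf_le_inf h2 h2'⟩
    · intro x hx
      exact le_inf ((inf_le_left : ofRight hi j c ⊓ ofRight hi j c' ≤ _).2 hx)
        ((inf_le_right : ofRight hi j c ⊓ ofRight hi j c' ≤ _).2 hx)

theorem leftHom_injective (hj : Function.Injective j) : Function.Injective (leftHom i hj) :=
  fun _ _ h => le_antisymm ((ofLeft_le_ofLeft (hj := hj)).1 h.le)
    ((ofLeft_le_ofLeft (hj := hj)).1 h.ge)

theorem rightHom_injective (hi : Function.Injective i) : Function.Injective (rightHom hi j) :=
  fun _ _ h => le_antisymm ((ofRight_le_ofRight (hi := hi)).1 h.le)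
    ((ofRight_le_ofRight (hi := hi)).1 h.ge)

/-- Each pair contains the generator of the other, with `a` itself as the witness. -/
theorem leftHom_apply_eq (hi : Function.Injective i) (hj : Function.Injective j) (a : A) :
    leftHom i hj (i a) = rightHom hi j (j a) :=
  le_antisymm ((ofLeft_le_iff (hj := hj)).2 ⟨a, le_rfl, le_rfl⟩)
    ((ofRight_le_iff (hi := hi)).2 ⟨a, le_rfl, le_rfl⟩)

end LatticeAmalgam

/-! ### Extension problems and enumeration of finite lattices -/

/-- A finite lattice, bundled. -/
structure FiniteLattice where
  carrier : Type u
  [lattice : Lattice carrier]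
  [finite : Finite carrier]

namespace FiniteLattice

instance : CoeSort FiniteLattice.{u} (Type u) := ⟨carrier⟩

attribute [instance] lattice finite

/-- Every embedding of a sublattice of `M` into `B` is solved along `f : M → N`: it extends to an
embedding of `B` into `N`. -/
def Solves {M N : FiniteLattice.{u}} (f : LatticeHom M N) (B : FiniteLattice.{u}) : Prop :=
  ∀ (A : Sublattice M) (i : LatticeHom A B), Function.Injective i →
    ∃ j : LatticeHom B N, Function.Injective j ∧ ∀ a : A, j (i a) = f a

/-- There are only finitely many problems `(A, i)`. Amalgamating one at a time solves them all,
since a solution persists under composition with later embeddings. -/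
theorem exists_solves (M B : FiniteLattice.{u}) :
    ∃ (N : FiniteLattice.{u}) (f : LatticeHom M N), Function.Injective f ∧ Solves f B := by
  suffices h : ∀ S : Set (Σ A : Sublattice M, LatticeHom A B), S.Finite →
      ∃ (N : FiniteLattice.{u}) (f : LatticeHom M N), Function.Injective f ∧
        ∀ P ∈ S, Function.Injective P.2 →
          ∃ j : LatticeHom B N, Function.Injective j ∧ ∀ a : P.1, j (P.2 a) = f a by
    have h1 : Finite (Sublattice M) := Finite.of_injective _ SetLike.coe_injective
    have h2 (A : Sublattice M) : Finite (LatticeHom A B) :=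
      Finite.of_injective _ DFunLike.coe_injective
    obtain ⟨N, f, hf, hN⟩ := h Set.univ Set.finite_univ
    exact ⟨N, f, hf, fun A i hi => hN ⟨A, i⟩ trivial hi⟩
  intro S hS
  induction S, hS using Set.Finite.induction_on with
  | empty => exact ⟨M, LatticeHom.id M, Function.injective_id, by simp⟩
  | @insert P S _ _ ih =>
    obtain ⟨N, f, hf, hN⟩ := ih
    by_cases hP : Function.Injective P.2
    · have hfP : Function.Injective (f.comp P.1.subtype) := hf.comp Subtype.coe_injective
      refine ⟨⟨LatticeAmalgam.IdealPair (f.comp P.1.subtype) P.2⟩,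
        (LatticeAmalgam.leftHom _ hP).comp f, (LatticeAmalgam.leftHom_injective hP).comp hf, ?_⟩
      rintro Q (rfl | hQ) hQi
      · exact ⟨LatticeAmalgam.rightHom hfP _, LatticeAmalgam.rightHom_injective hfP,
          fun a => (LatticeAmalgam.leftHom_apply_eq hfP hP a).symm⟩
      · obtain ⟨j, hj, hja⟩ := hN Q hQ hQi
        refine ⟨(LatticeAmalgam.leftHom _ hP).comp j,
          (LatticeAmalgam.leftHom_injective hP).comp hj, fun a => ?_⟩
        rw [LatticeHom.comp_apply, LatticeHom.comp_apply, hja]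
    · refine ⟨N, f, hf, ?_⟩
      rintro Q (rfl | hQ) hQi
      exacts [(hP hQi).elim, hN Q hQ hQi]

instance (α : Type*) [Finite α] : Finite (Lattice α) :=
  Finite.of_injective (fun i : Lattice α => i.le) fun _ _ h =>
    Lattice.ext fun x y => iff_of_eq (congrFun₂ h x y)

/-- A lattice structure on `Fin k` as a bundled lattice. -/
def ofFin (s : Σ k, Lattice (Fin k)) : FiniteLattice.{0} :=
  letI := s.2; ⟨Fin s.1⟩

/-- Up to isomorphism there are countably many finite lattices. -/
theorem exists_enumeration : ∃ B : ℕ → FiniteLattice.{0},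
    ∀ (M : Type) [Lattice M] [Finite M] (m : ℕ), ∃ n ≥ m, Nonempty (M ≃o B n) := by
  have hne : Nonempty (Σ k, Lattice (Fin k)) := ⟨⟨1, inferInstance⟩⟩
  obtain ⟨e, he⟩ := exists_surjective_nat (Σ k, Lattice (Fin k))
  refine ⟨fun n => ofFin (e n.unpair.1), fun M _ _ m => ?_⟩
  obtain ⟨k, ⟨g⟩⟩ := Finite.exists_equiv_fin M
  let inst : Lattice (Fin k) :=
    { le := fun x y => g.symm x ≤ g.symm y
      lt := fun x y => g.symm x < g.symm y
      lt_iff_le_not_ge := fun _ _ => lt_iff_le_not_ge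
      le_refl := fun _ => le_rfl
      le_trans := fun _ _ _ => le_trans
      le_antisymm := fun _ _ h h' => g.symm.injective (h.antisymm h')
      sup := fun x y => g (g.symm x ⊔ g.symm y)
      inf := fun x y => g (g.symm x ⊓ g.symm y)
      le_sup_left := by simp
      le_sup_right := by simp
      sup_le := by simp +contextual
      inf_le_left := by simp
      inf_le_right := by simp
      le_inf := by simp +contextual }
  obtain ⟨c, hc⟩ := he ⟨k, inst⟩
  -- Only the first component of the unpaired index is used, so each lattice recurs; taking the
  -- second component to be `m` puts the index beyond `m`.
  refine ⟨Nat.pair c m, Nat.right_le_pair c m, ?_⟩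
  have hn : ofFin (e (Nat.pair c m).unpair.1) = ofFin ⟨k, inst⟩ := by rw [Nat.unpair_pair, hc]
  beta_reduce
  rw [hn]
  exact ⟨{ toEquiv := g
           map_rel_iff' := by
            intro a b
            exact (by simp : g.symm (g a) ≤ g.symm (g b) ↔ a ≤ b) }⟩

end FiniteLattice

/-! ### Direct limits of lattices -/

namespace DirectLimit

variable {ι : Type*} [Preorder ι] [IsDirectedOrder ι] {F : ι → Type*} [∀ i, Lattice (F i)]
  (f : ∀ i j, i ≤ j → LatticeHom (F i) (F j)) [DirectedSystem F (f · · ·)]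

noncomputable instance : Max (DirectLimit F f) :=
  ⟨map₂ f f f (fun _ => (· ⊔ ·)) fun i j h => map_sup (f i j h)⟩

noncomputable instance : Min (DirectLimit F f) :=
  ⟨map₂ f f f (fun _ => (· ⊓ ·)) fun i j h => map_inf (f i j h)⟩

theorem mk_sup_mk (i : ι) (x y : F i) :
    (⟦⟨i, x⟩⟧ ⊔ ⟦⟨i, y⟩⟧ : DirectLimit F f) = ⟦⟨i, x ⊔ y⟩⟧ := map₂_def ..

theorem mk_inf_mk (i : ι) (x y : F i) :
    (⟦⟨i, x⟩⟧ ⊓ ⟦⟨i, y⟩⟧ : DirectLimit F f) = ⟦⟨i, x ⊓ y⟩⟧ := map₂_def ..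

noncomputable instance : Lattice (DirectLimit F f) :=
  Lattice.mk'
    (DirectLimit.induction₂ f fun i x y => by simp only [mk_sup_mk, sup_comm])
    (DirectLimit.induction₃ f fun i x y z => by simp only [mk_sup_mk, sup_assoc])
    (DirectLimit.induction₂ f fun i x y => by simp only [mk_inf_mk, inf_comm])
    (DirectLimit.induction₃ f fun i x y z => by simp only [mk_inf_mk, inf_assoc])
    (DirectLimit.induction₂ f fun i x y => by simp only [mk_sup_mk, mk_inf_mk, sup_inf_self])
    (DirectLimit.induction₂ f fun i x y => by simp only [mk_sup_mk, mk_inf_mk, inf_sup_self])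

/-- The canonical map of a lattice of the system into the direct limit. -/
def latticeOf (i : ι) : LatticeHom (F i) (DirectLimit F f) where
  toFun x := ⟦⟨i, x⟩⟧
  map_sup' x y := (mk_sup_mk f i x y).symm
  map_inf' x y := (mk_inf_mk f i x y).symm

variable {f}

theorem latticeOf_apply_map {i j : ι} (h : i ≤ j) (x : F i) :
    latticeOf f j (f i j h x) = latticeOf f i x := mk_apply i j x h

theorem latticeOf_injective (hf : ∀ i j h, Function.Injective (f i j h)) (i : ι) :
    Function.Injective (latticeOf f i) := mk_injective f hf i

theorem exists_latticeOf (x : DirectLimit F f) : ∃ i y, latticeOf f i y = x := by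
  obtain ⟨i, y, rfl⟩ := exists_eq_mk f x
  exact ⟨i, y, rfl⟩

theorem exists_subset_range_latticeOf [Nonempty ι] {s : Set (DirectLimit F f)} (hs : s.Finite) :
    ∃ i, s ⊆ Set.range (latticeOf f i) := by
  induction s, hs using Set.Finite.induction_on with
  | empty => exact ⟨Classical.arbitrary ι, Set.empty_subset _⟩
  | @insert x s _ _ ih =>
    obtain ⟨i, hi⟩ := ih
    obtain ⟨j, y, rfl⟩ := exists_latticeOf x
    obtain ⟨k, hik, hjk⟩ := exists_ge_ge i j
    refine ⟨k, Set.insert_subset ⟨f j k hjk y, latticeOf_apply_map hjk y⟩ fun z hz => ?_⟩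
    obtain ⟨w, rfl⟩ := hi hz
    exact ⟨f i k hik w, latticeOf_apply_map hik w⟩

end DirectLimit

/-! ### The limit of a chain and existence -/

namespace FiniteLattice

variable {F : ℕ → FiniteLattice.{u}} (f : ∀ n, LatticeHom (F n) (F (n + 1)))

/-- The composite maps of a chain of finite lattices. -/
def chainMap (m n : ℕ) (h : m ≤ n) : LatticeHom (F m) (F n) :=
  Nat.leRec (motive := fun k _ => LatticeHom (F m) (F k)) (LatticeHom.id _)
    (fun k _ g => (f k).comp g) h

theorem chainMap_self (m : ℕ) : chainMap f m m le_rfl = LatticeHom.id _ := Nat.leRec_self ..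

theorem chainMap_succ {m n : ℕ} (h : m ≤ n) :
    chainMap f m (n + 1) (h.trans n.le_succ) = (f n).comp (chainMap f m n h) :=
  Nat.leRec_succ ..

instance : DirectedSystem (fun n => F n) (chainMap f · · ·) where
  map_self m x := by rw [chainMap_self]; rfl
  map_map k j i hij hjk x := by
    induction hjk with
    | refl => rw [chainMap_self]; rfl
    | step h ih =>
      rw [chainMap_succ f h, chainMap_succ f (hij.trans h), LatticeHom.comp_apply, ih]; rfl

theorem chainMap_injective (hf : ∀ n, Function.Injective (f n)) (m n : ℕ) (h : m ≤ n) :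
    Function.Injective (chainMap f m n h) := by
  induction h with
  | refl => rw [chainMap_self]; exact Function.injective_id
  | step h ih => rw [chainMap_succ f h]; exact (hf _).comp ih

/-- The limit of a chain of finite lattices is typical if the `n`-th step solves all extension
problems for the `n`-th member of an enumeration of the finite lattices. -/
theorem isTypical_directLimit (hf : ∀ n, Function.Injective (f n)) {B : ℕ → FiniteLattice.{u}}
    (hB : ∀ (M : Type u) [Lattice M] [Finite M] (m : ℕ), ∃ n ≥ m, Nonempty (M ≃o B n))
    (hfB : ∀ n, Solves (f n) (B n)) :
    IsTypicalCountableLattice (DirectLimit (fun n => F n) (chainMap f)) := by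
  let of := DirectLimit.latticeOf (chainMap f)
  have hof : ∀ n, Function.Injective (of n) :=
    DirectLimit.latticeOf_injective (chainMap_injective f hf)
  have hext : ∀ A : Sublattice (DirectLimit (fun n => F n) (chainMap f)),
      (A : Set (DirectLimit (fun n => F n) (chainMap f))).Finite →
      ∀ (M : Type u) [Lattice M] [Finite M] (i : LatticeHom A M), Function.Injective i →
        ∃ j : LatticeHom M (DirectLimit (fun n => F n) (chainMap f)),
          Function.Injective j ∧ ∀ a : A, j (i a) = a := by
    intro A hA M _ _ i hi
    obtain ⟨m, hm⟩ := DirectLimit.exists_subset_range_latticeOf hA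
    obtain ⟨n, hmn, ⟨g⟩⟩ := hB M m
    -- The problem is pulled back to the stage `F n`. Since `n ≥ m`, all of `A` is already present
    -- there, so solving it on the preimage solves it on `A`.
    let r : LatticeHom (A.comap (of n)) A :=
      { toFun := fun x => ⟨of n x, x.2⟩
        map_sup' := fun x y => Subtype.ext (map_sup (of n) _ _)
        map_inf' := fun x y => Subtype.ext (map_inf (of n) _ _) }
    have hr : Function.Injective r := fun x y h => Subtype.ext (hof n (congrArg Subtype.val h))
    let G : LatticeHom M (B n) := (g : LatticeHom M (B n))
    have hG : Function.Injective G := g.injective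
    obtain ⟨j, hj, hja⟩ := hfB n (A.comap (of n)) ((G.comp i).comp r)
      ((hG.comp hi).comp hr)
    refine ⟨(of (n + 1)).comp (j.comp G), (hof _).comp (hj.comp hG), fun a => ?_⟩
    obtain ⟨x, hx⟩ := hm a.2
    let y := chainMap f m n hmn x
    have hy : of n y = a :=
      (DirectLimit.latticeOf_apply_map (f := chainMap f) hmn x).trans hx
    have hyA : y ∈ A.comap (of n) := by rw [Sublattice.mem_comap, hy]; exact a.2
    have h1 : r ⟨y, hyA⟩ = a := Subtype.ext hy
    have h2 := hja ⟨y, hyA⟩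
    rw [LatticeHom.comp_apply, LatticeHom.comp_apply, h1] at h2
    rw [LatticeHom.comp_apply, LatticeHom.comp_apply, h2]
    have h3 := DirectLimit.latticeOf_apply_map (f := chainMap f) n.le_succ y
    rw [chainMap_succ f le_rfl, chainMap_self] at h3
    exact h3.trans hy
  refine ⟨?_, ?_, hext, ?_⟩
  · exact Quotient.countable
  · intro s hs
    obtain ⟨n, hn⟩ := DirectLimit.exists_subset_range_latticeOf hs
    exact ⟨Sublattice.LatticeHom.range (of n), hn, Set.finite_range (of n)⟩
  · intro M _ _
    -- Universality is the extension property over the empty sublattice.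
    obtain ⟨j, hj, -⟩ := hext ⊥ Set.finite_empty M
      ⟨⟨fun a => a.2.elim, fun a => a.2.elim⟩, fun a => a.2.elim⟩ fun a => a.2.elim
    exact ⟨j, hj⟩

theorem exists_isTypicalCountableLattice :
    ∃ (L : Type) (_ : Lattice L), IsTypicalCountableLattice L := by
  obtain ⟨B, hB⟩ := exists_enumeration
  choose N g hg hgB using fun M n => exists_solves M (B n)
  let F : ℕ → FiniteLattice.{0} := fun n => Nat.rec ⟨PUnit⟩ (fun n M => N M n) n
  exact ⟨_, _, isTypical_directLimit (F := F) (fun n => g (F n) n) (fun n => hg (F n) n) hB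
    fun n => hgB (F n) n⟩

end FiniteLattice

theorem mainTheorem3 :
    (∃ (L : Type) (_ : Lattice L), IsTypicalCountableLattice L) ∧
    ∀ (L : Type u) [Lattice L], IsTypicalCountableLattice L →
      MonotoneInterpolationProperty L ∧ IsSimpleLattice L :=
  ⟨FiniteLattice.exists_isTypicalCountableLattice, fun _ _ hL =>
    ⟨hL.monotoneInterpolationProperty,
      hL.monotoneInterpolationProperty.isSimpleLattice hL.locally_finite⟩⟩
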